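/- All graphs are finite and simple. Let $H$ be a graph with a specified Hamiltonian cycle $C$ (the reference cycle). Edges of $H$ not in $C$ are called chords, and two non-incident chords $ab$, $cd$ cross if $a,c,b,d$ appear on $C$ in the cyclic order $a,c,b,d$. The graph $H$ (with $C$) is of type I if every chord crosses at most one other chord and, whenever two chords $ab$, $cd$ cross, either both $ac,bd$ are edges of $C$ or both $ad,bc$ are edges of $C$. Let $H$ be of type I with reference cycle $C$, and let $ab$, $cd$ be two distinct edges of $C$ such that every chord has one end in each of the two paths of $C\setminus\{ab,cd\}$. If $ab$ and $cd$ share an end, say $a=d$, then $H$ is a fan with corners $a,b,c$ and center $a$. If $ab$ and $cd$ share no end, then for every $F\subseteq\{ab,cd\}$ such that $H\setminus F$ has minimum degree at least two, $H\setminus F$ is a strip with corners $a,b,c,d$. An augmentation of a graph $G_0$ is a graph obtained from $G_0$ by taking finitely many fans and strips, disjoint from each other and from $G_0$, and identifying the corners of each of them with distinct vertices of $G_0$ (parallel edges being merged), in such a way that if two corners of different fans or strips are identified with the same vertex of $G_0$, then one of them is the center of a fan and the other is either the center of a fan or a corner of a strip. Lemma. There is a function $f$, namely $f(n)=10n\cdot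 2^n$, such that for every integer $n\ge 0$, no augmentation of a graph on at most $n$ vertices has a $K_{2,f(n)}$-minor. -/

import Mathlib

namespace Aug

universe u v

/-- `H` is a minor of `G`: there are pairwise disjoint connected (in particular nonempty) branch
sets in `G`, one for each vertex of `H`, such that the branch sets of adjacent vertices of `H` are
joined by an edge of `G`. -/
def IsMinor {U : Type u} {V : Type v} (H : SimpleGraph U) (G : SimpleGraph V) : Prop :=
  ∃ B : U → Set V,
    (∀ x, (G.induce (B x)).Connected) ∧
    (∀ x y, x ≠ y → Disjoint (B x) (B y)) ∧
    (∀ x y, H.Adj x y → ∃ s ∈ B x, ∃ t ∈ B y, G.Adj s t)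

/-- The complete bipartite graph `K_{2,m}`. -/
abbrev K2 (m : ℕ) : SimpleGraph (Fin 2 ⊕ Fin m) := completeBipartiteGraph (Fin 2) (Fin m)

/-- A reference cycle of `H`, that is, a specified Hamiltonian cycle, given by an enumeration of
the vertices of `H` around the cycle. -/
structure RefCycle {V : Type u} (H : SimpleGraph V) where
  len : ℕ
  three_le : 3 ≤ len
  vert : Fin len ≃ V
  adj : ∀ i j, (SimpleGraph.cycleGraph len).Adj i j → H.Adj (vert i) (vert j)

namespace RefCycle

variable {V : Type u} {H : SimpleGraph V} (C : RefCycle H)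

/-- The reference cycle as a graph on the vertices of `H`. -/
def cycle : SimpleGraph V := (SimpleGraph.cycleGraph C.len).map C.vert

/-- `ab` is a chord: an edge of `H` that is not an edge of the reference cycle. -/
def Chord (a b : V) : Prop := H.Adj a b ∧ ¬ C.cycle.Adj a b

/-- `a, c, b, d` are distinct and appear on the reference cycle in the order `a, c, b, d, a`,
with respect to the given direction of the cycle. -/
def InOrder (a c b d : V) : Prop :=
  sbtw (C.vert.symm a) (C.vert.symm c) (C.vert.symm b) ∧
  sbtw (C.vert.symm b) (C.vert.symm d) (C.vert.symm a)

/-- The pairs `ab` and `cd` cross (in the second case `a, c, b, d, a` is the order in the reverse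
direction). -/
def Cross (a b c d : V) : Prop := C.InOrder a c b d ∨ C.InOrder a d b c

/-- The type-I condition for `H` with reference cycle `C`: every chord crosses at most one other
chord, and if two chords `ab`, `cd` cross then `ac, bd` are both edges of `C` or `ad, bc` are
both edges of `C`. -/
def IsTypeI : Prop :=
  (∀ a b c d c' d' : V, C.Chord a b → C.Chord c d → C.Chord c' d' →
    C.Cross a b c d → C.Cross a b c' d' → s(c, d) = s(c', d')) ∧
  (∀ a b c d : V, C.Chord a b → C.Chord c d → C.Cross a b c d →
    (C.cycle.Adj a c ∧ C.cycle.Adj b d) ∨ (C.cycle.Adj a d ∧ C.cycle.Adj b c))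

/-- All chords are between the two paths of `C` minus the edges `e` and `f`: no chord has both
ends in the same component of `C \ {e, f}`. (Used for distinct edges `e`, `f` of `C`.) -/
def ChordsBetween (e f : Sym2 V) : Prop :=
  ∀ x y : V, C.Chord x y → ¬ (C.cycle.deleteEdges {e, f}).Reachable x y

end RefCycle

/-- `H` is a fan with corners `a, b, c` and center `a`. -/
def IsFan {V : Type u} (H : SimpleGraph V) (a b c : V) : Prop :=
  ∃ C : RefCycle H, C.IsTypeI ∧ b ≠ c ∧ C.cycle.Adj a b ∧ C.cycle.Adj a c ∧
    C.ChordsBetween s(a, b) s(a, c)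

/-- `J` is a strip with corners `a, b, c, d`: it is obtained from a type-I graph `H` by deleting
a subset `F` of two nonincident edges `ab`, `cd` of the reference cycle, where all chords are
between the two paths of the cycle minus `ab`, `cd`, and `J` has minimum degree at least two. -/
def IsStrip {V : Type u} (J : SimpleGraph V) (a b c d : V) : Prop :=
  ∃ (H : SimpleGraph V) (C : RefCycle H) (F : Set (Sym2 V)),
    C.IsTypeI ∧ C.cycle.Adj a b ∧ C.cycle.Adj c d ∧
    a ≠ c ∧ a ≠ d ∧ b ≠ c ∧ b ≠ d ∧
    C.ChordsBetween s(a, b) s(c, d) ∧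
    F ⊆ {s(a, b), s(c, d)} ∧ J = H.deleteEdges F ∧
    ∀ x, 2 ≤ (J.neighborSet x).encard

/-- A fan or a strip, with its set of corners and, if it is a fan, its center. The vertex type is
in the lowest universe since fans and strips are finite graphs and matter up to isomorphism. -/
structure Piece where
  Vtx : Type
  graph : SimpleGraph Vtx
  corners : Set Vtx
  center : Option Vtx
  spec :
    (∃ a b c, IsFan graph a b c ∧ corners = {a, b, c} ∧ center = some a) ∨
    (∃ a b c d, IsStrip graph a b c d ∧ corners = {a, b, c, d} ∧ center = none)

/-- The data for adding finitely many disjoint fans and strips to a graph with vertex type `V`: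
the corners of each piece are identified with distinct vertices of `V`, and if corners of two
pieces are identified with the same vertex then one of them is the center of a fan and the other
is the center of a fan or a corner of a strip. -/
structure Attachment (V : Type u) where
  ι : Type
  finite_ι : Finite ι
  piece : ι → Piece
  att : ∀ i, (piece i).corners → V
  att_injective : ∀ i, Function.Injective (att i)
  compat : ∀ i j, i ≠ j → ∀ (x : (piece i).corners) (y : (piece j).corners), att i x = att j y →
    ((piece i).center = some x.1 ∧
      ((piece j).center = some y.1 ∨ (piece j).center = none)) ∨
    ((piece j).center = some y.1 ∧
      ((piece i).center = some x.1 ∨ (piece i).center = none))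

namespace Attachment

variable {V : Type u} (A : Attachment V)

/-- The vertices after the identification: those of `V`, and the non-corner vertices of the
pieces. -/
abbrev Vertex : Type u := V ⊕ (Σ i : A.ι, {x : (A.piece i).Vtx // x ∉ (A.piece i).corners})

open Classical in
/-- The position of the vertices of the `i`-th piece after the identification. -/
noncomputable def place (i : A.ι) (x : (A.piece i).Vtx) : A.Vertex :=
  if h : x ∈ (A.piece i).corners then Sum.inl (A.att i ⟨x, h⟩) else Sum.inr ⟨i, x, h⟩

/-- The graph obtained from `G₀` by adding the pieces. -/
noncomputable def graph (G₀ : SimpleGraph V) : SimpleGraph A.Vertex :=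
  G₀.map Sum.inl ⊔ ⨆ i, (A.piece i).graph.map (A.place i)

end Attachment

/-- `G` is (isomorphic to) an augmentation of `G₀`. -/
def IsAugmentation {V : Type u} {W : Type v} (G₀ : SimpleGraph V) (G : SimpleGraph W) : Prop :=
  ∃ A : Attachment V, Nonempty (G ≃g A.graph G₀)

end Aug

/-! The bound comes from showing that `K_{2,m}` needs `m ≤ |V| + 64 p`, where `p` is the number of
pieces, and that `p ≤ |V|`.

Fix the branch sets `X`, `Y` of the two vertices on the small side. Each of the `m` other branch
sets `T` either contains a vertex of `G₀` or lies inside one piece, away from its corners. It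
remains to hit the latter sets by 64 vertices per piece.

Apart from edges between corners, a piece is a ladder whose crossing rungs join consecutive vertices
on both sides. A monotone staircase of separations sweeps it (`exists_staircase`) and gives each
vertex a time interval, with at most two vertices alive at any time and adjacent vertices at most
one time step apart (`IsLayout`). Three disjoint connected sets cannot share a time, so a set `T`
adjacent to a component of `X` and to one of `Y` must reach just beyond an end of their common time
span, where four vertices hit all such `T` (`exists_hitting_four`).

Inside a piece each of `X`, `Y` has at most four components, since a component without a corner is
the whole set. This gives `4 * 4 * 4 = 64`. -/

namespace Aug

/-! ### Staircases of separations in a ladder -/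

/-- A separation of the ladder with rungs `R`: no rung passes strictly across `(i, j)`. -/
def Separates (R : ℕ → ℕ → Prop) (s : ℕ × ℕ) : Prop :=
  ∀ i j, R i j → ¬ (i < s.1 ∧ s.2 < j) ∧ ¬ (s.1 < i ∧ j < s.2)

/-- If neither coordinate can be advanced alone, there are rungs from `i` to beyond `j` and from
beyond `i` to `j`. They cross, so they join `i` to `j + 1` and `i + 1` to `j`, and a diagonal step
passes both. -/
theorem Separates.exists_next {R : ℕ → ℕ → Prop} {k l : ℕ} (hkl : ∀ i j, R i j → i ≤ k ∧ j ≤ l)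
    (hR : ∀ i j i' j', R i j → R i' j' → i < i' → j' < j → i' = i + 1 ∧ j = j' + 1)
    {s : ℕ × ℕ} (hs : Separates R s) (h1 : s.1 ≤ k) (h2 : s.2 ≤ l) :
    ∃ s' : ℕ × ℕ, Separates R s' ∧ s'.1 ≤ k ∧ s'.2 ≤ l ∧ s.1 ≤ s'.1 ∧ s'.1 ≤ s.1 + 1 ∧
      s.2 ≤ s'.2 ∧ s'.2 ≤ s.2 + 1 ∧ (s.1 + s.2 < k + l → s.1 + s.2 < s'.1 + s'.2) := by
  obtain ⟨i, j⟩ := s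
  simp only at h1 h2 ⊢
  rcases h1.eq_or_lt with rfl | h1
  · rcases h2.eq_or_lt with rfl | h2
    · exact ⟨(i, j), hs, by simp⟩
    · refine ⟨(i, j + 1), fun x y hxy => ?_, by simp; omega⟩
      have h3 := hs x y hxy
      have h4 := hkl x y hxy
      simp only at h3 ⊢
      omega
  rcases h2.eq_or_lt with rfl | h2
  · refine ⟨(i + 1, j), fun x y hxy => ?_, by simp; omega⟩
    have h3 := hs x y hxy
    have h4 := hkl x y hxy
    simp only at h3 ⊢
    omega
  by_cases ha : Separates R (i + 1, j)
  · exact ⟨_, ha, by simp; omega⟩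
  by_cases hb : Separates R (i, j + 1)
  · exact ⟨_, hb, by simp; omega⟩
  have ha' : ∃ y, R i y ∧ j < y := by
    by_contra! hc
    refine ha fun x y hxy => ?_
    have h3 := hs x y hxy
    simp only at h3 ⊢
    rcases eq_or_ne x i with rfl | hx
    · have := hc y hxy
      omega
    · omega
  have hb' : ∃ x, R x j ∧ i < x := by
    by_contra! hc
    refine hb fun x y hxy => ?_
    have h3 := hs x y hxy
    simp only at h3 ⊢
    rcases eq_or_ne y j with rfl | hx
    · have := hc x hxy
      omega
    · omega
  obtain ⟨y, hy, hjy⟩ := ha'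
  obtain ⟨x, hx, hix⟩ := hb'
  obtain ⟨rfl, rfl⟩ := hR _ _ _ _ hy hx hix hjy
  refine ⟨(i + 1, j + 1), fun x y hxy => ?_, by simp; omega⟩
  have h3 := hs x y hxy
  simp only at h3 ⊢
  refine ⟨fun h => ?_, fun h => ?_⟩
  · obtain rfl : x = i := by omega
    have := hR _ _ _ _ hxy hx (by omega) (by omega)
    omega
  · obtain rfl : y = j := by omega
    have := hR _ _ _ _ hy hxy (by omega) (by omega)
    omega

/-- Before `(k, l)` every step increases the coordinate sum, so `k + l` steps suffice; diagonal
steps may bring the arrival earlier, after which the staircase rests. -/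
theorem exists_staircase {R : ℕ → ℕ → Prop} {k l : ℕ} (hkl : ∀ i j, R i j → i ≤ k ∧ j ≤ l)
    (hR : ∀ i j i' j', R i j → R i' j' → i < i' → j' < j → i' = i + 1 ∧ j = j' + 1) :
    ∃ S : ℕ → ℕ × ℕ, S 0 = (0, 0) ∧ S (k + l) = (k, l) ∧ (∀ t, Separates R (S t)) ∧
      ∀ t, (S t).1 ≤ (S (t + 1)).1 ∧ (S (t + 1)).1 ≤ (S t).1 + 1 ∧
        (S t).2 ≤ (S (t + 1)).2 ∧ (S (t + 1)).2 ≤ (S t).2 + 1 := by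
  choose next hnext using fun s : {s : ℕ × ℕ // Separates R s ∧ s.1 ≤ k ∧ s.2 ≤ l} =>
    s.2.1.exists_next hkl hR s.2.2.1 s.2.2.2
  let S : ℕ → {s : ℕ × ℕ // Separates R s ∧ s.1 ≤ k ∧ s.2 ≤ l} := fun t =>
    Nat.rec ⟨(0, 0), fun i j _ => by simp, by simp, by simp⟩
      (fun _ s => ⟨next s, (hnext s).1, (hnext s).2.1, (hnext s).2.2.1⟩) t
  have hS : ∀ t, (S (t + 1)).1 = next (S t) := fun t => rfl
  have hsum : ∀ t, t ≤ k + l → t ≤ (S t).1.1 + (S t).1.2 := by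
    intro t
    induction t with
    | zero => simp
    | succ t ih =>
      intro ht
      have h1 := ih (by omega)
      have h2 := hnext (S t)
      rw [← hS] at h2
      omega
  refine ⟨fun t => (S t).1, rfl, ?_, fun t => (S t).2.1, fun t => ?_⟩
  · have h1 := hsum _ le_rfl
    have h2 := (S (k + l)).2
    exact Prod.ext (by simp only; omega) (by simp only; omega)
  · have h2 := hnext (S t)
    rw [← hS] at h2
    exact ⟨h2.2.2.2.1, h2.2.2.2.2.1, h2.2.2.2.2.2.1, h2.2.2.2.2.2.2.1⟩

/-- A monotone walk with increments at most one skips no value and takes each on an interval of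
times. -/
theorem exists_level_intervals {s : ℕ → ℕ} {k K : ℕ} (h0 : s 0 = 0) (hK : s K = k)
    (hs : ∀ t, s t ≤ s (t + 1) ∧ s (t + 1) ≤ s t + 1) :
    ∃ lo hi : ℕ → ℕ, ∀ i ≤ k, lo i ≤ hi i ∧ lo i ≤ K ∧ hi i ≤ K ∧
      (∀ t, lo i ≤ t → t ≤ hi i → s t = i) ∧ (∀ t, t < lo i → s t < i) ∧
      ∀ t, hi i < t → t ≤ K → i < s t := by
  classical
  have hmono : Monotone s := monotone_nat_of_le_succ fun t => (hs t).1
  have hex : ∀ i, ∃ t, i ≤ k → i ≤ s t := fun i => ⟨K, fun h => by omega⟩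
  refine ⟨fun i => Nat.find (hex i), fun i => Nat.findGreatest (fun t => s t ≤ i) K,
    fun i hi => ?_⟩
  have hlo : i ≤ s (Nat.find (hex i)) := Nat.find_spec (hex i) hi
  have hloK : Nat.find (hex i) ≤ K := Nat.find_min' _ fun h => by omega
  have hlt : ∀ t, t < Nat.find (hex i) → s t < i := fun t ht => by
    have := Nat.find_min (hex i) ht
    omega
  have hlo' : s (Nat.find (hex i)) ≤ i := by
    rcases Nat.eq_zero_or_pos (Nat.find (hex i)) with h | h
    · rw [h, h0]
      exact Nat.zero_le _
    · have h1 := hlt (Nat.find (hex i) - 1) (by omega)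
      have h2 := (hs (Nat.find (hex i) - 1)).2
      rw [Nat.sub_add_cancel h] at h2
      omega
  have hhi : s (Nat.findGreatest (fun t => s t ≤ i) K) ≤ i :=
    Nat.findGreatest_spec (P := fun t => s t ≤ i) hloK hlo'
  refine ⟨Nat.le_findGreatest hloK hlo', hloK, Nat.findGreatest_le _, fun t h1 h2 => ?_, hlt,
    fun t h1 h2 => ?_⟩
  · exact le_antisymm ((hmono h2).trans hhi) (hlo.trans (hmono h1))
  · exact not_le.1 (Nat.findGreatest_is_greatest (P := fun t => s t ≤ i) h1 h2)

/-! ### Layouts of width two -/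

/-- Assigning to the vertices time intervals such that every time belongs to at most two of them,
and the intervals of adjacent vertices intersect or are consecutive. -/
structure IsLayout {V : Type*} (D : V → V → Prop) (lo hi : V → ℕ) : Prop where
  le : ∀ v, lo v ≤ hi v
  width : ∀ t, ∃ p q, ∀ v, lo v ≤ t → t ≤ hi v → v = p ∨ v = q
  near : ∀ u v, D u v → lo u ≤ hi v + 1

/-- Positions up to `k` form one side and position `k + l + 1 - j` is vertex `j` of the other. A
vertex is alive while the staircase stands at its index. -/
theorem exists_isLayout_of_ladder {V : Type*} {D : V → V → Prop} (hsymm : ∀ u v, D u v → D v u)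
    (hirr : ∀ v, ¬ D v v) {pos : V → ℕ} (hpos : Function.Injective pos) {k l : ℕ}
    (hlt : ∀ v, pos v < k + l + 2) {R : ℕ → ℕ → Prop} (hkl : ∀ i j, R i j → i ≤ k ∧ j ≤ l)
    (hR : ∀ i j i' j', R i j → R i' j' → i < i' → j' < j → i' = i + 1 ∧ j = j' + 1)
    (hD : ∀ u v, D u v → pos u < pos v → (pos v = pos u + 1 ∧ pos u ≠ k) ∨
      (pos u ≤ k ∧ k < pos v ∧ R (pos u) (k + l + 1 - pos v))) [Nonempty V] :
    ∃ lo hi : V → ℕ, IsLayout D lo hi := by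
  classical
  obtain ⟨S, hS0, hSK, hsep, hstep⟩ := exists_staircase hkl hR
  obtain ⟨lp, hp, hP⟩ := exists_level_intervals (s := fun t => (S t).1) (k := k) (K := k + l)
    (by simp [hS0]) (by simp [hSK]) fun t => ⟨(hstep t).1, (hstep t).2.1⟩
  obtain ⟨lq, hq, hQ⟩ := exists_level_intervals (s := fun t => (S t).2) (k := l) (K := k + l)
    (by simp [hS0]) (by simp [hSK]) fun t => ⟨(hstep t).2.2.1, (hstep t).2.2.2⟩
  have key : ∀ u v, D u v → pos u < pos v →
      (if pos u ≤ k then lp (pos u) else lq (k + l + 1 - pos u)) ≤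
        (if pos v ≤ k then hp (pos v) else hq (k + l + 1 - pos v)) + 1 ∧
      (if pos v ≤ k then lp (pos v) else lq (k + l + 1 - pos v)) ≤
        (if pos u ≤ k then hp (pos u) else hq (k + l + 1 - pos u)) + 1 := by
    intro u v huv hlt'
    have hu := hlt u
    have hv := hlt v
    rcases hD u v huv hlt' with ⟨h1, h2⟩ | ⟨h1, h2, h3⟩
    · by_cases h3 : pos v ≤ k
      · have h4 : pos u ≤ k := by omega
        simp only [h3, h4, if_true]
        obtain ⟨a1, a2, a3, a4, a5, a6⟩ := hP _ h3
        obtain ⟨b1, b2, b3, b4, b5, b6⟩ := hP _ h4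
        constructor
        · by_contra! hc
          have := b5 (hp (pos v)) (by omega)
          have := a4 (hp (pos v)) (by omega) (by omega)
          omega
        · by_contra! hc
          have := a5 (hp (pos u) + 1) (by omega)
          have := b6 (hp (pos u) + 1) (by omega) (by omega)
          omega
      · have h4 : ¬ pos u ≤ k := by omega
        simp only [h3, h4, if_false]
        obtain ⟨a1, a2, a3, a4, a5, a6⟩ := hQ (k + l + 1 - pos v) (by omega)
        obtain ⟨b1, b2, b3, b4, b5, b6⟩ := hQ (k + l + 1 - pos u) (by omega)
        constructor
        · by_contra! hc
          have := b5 (hq (k + l + 1 - pos v) + 1) (by omega)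
          have := a6 (hq (k + l + 1 - pos v) + 1) (by omega) (by omega)
          omega
        · by_contra! hc
          have := a5 (hq (k + l + 1 - pos u)) (by omega)
          have := b4 (hq (k + l + 1 - pos u)) (by omega) (by omega)
          omega
    · have h4 : ¬ pos v ≤ k := by omega
      simp only [h1, h4, if_true, if_false]
      obtain ⟨a1, a2, a3, a4, a5, a6⟩ := hP _ h1
      obtain ⟨b1, b2, b3, b4, b5, b6⟩ := hQ (k + l + 1 - pos v) (by omega)
      constructor
      · by_contra! hc
        -- Were the ends of a rung more than one step apart, then at a time in between the staircase
        -- would have left one end and not reached the other, so the rung would pass across a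
        -- separation.
        have h5 := a5 (hq (k + l + 1 - pos v) + 1) (by omega)
        have h6 := b6 (hq (k + l + 1 - pos v) + 1) (by omega) (by omega)
        exact (hsep _ _ _ h3).2 ⟨h5, h6⟩
      · by_contra! hc
        have h5 := b5 (hp (pos u) + 1) (by omega)
        have h6 := a6 (hp (pos u) + 1) (by omega) (by omega)
        exact (hsep _ _ _ h3).1 ⟨h6, h5⟩
  refine ⟨fun v => if pos v ≤ k then lp (pos v) else lq (k + l + 1 - pos v),
    fun v => if pos v ≤ k then hp (pos v) else hq (k + l + 1 - pos v), ?_, ?_, ?_⟩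
  · intro v
    split_ifs with h
    · exact (hP _ h).1
    · exact (hQ _ (by omega)).1
  · intro t
    have hinv : ∀ n, ∃ p, ∀ v, pos v = n → v = p := by
      intro n
      by_cases h : ∃ p, pos p = n
      · obtain ⟨p, rfl⟩ := h
        exact ⟨p, fun v hv => hpos hv⟩
      · exact ⟨Classical.arbitrary V, fun v hv => absurd ⟨v, hv⟩ h⟩
    obtain ⟨p, hp'⟩ := hinv (S t).1
    obtain ⟨q, hq'⟩ := hinv (k + l + 1 - (S t).2)
    refine ⟨p, q, fun v h1 h2 => ?_⟩
    have hv := hlt v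
    beta_reduce at h1 h2
    split_ifs at h1 h2 with h
    · exact Or.inl (hp' v ((hP _ h).2.2.2.1 t h1 h2).symm)
    · have := (hQ (k + l + 1 - pos v) (by omega)).2.2.2.1 t h1 h2
      exact Or.inr (hq' v (by omega))
  · intro u v huv
    rcases lt_trichotomy (pos u) (pos v) with h | h | h
    · exact (key u v huv h).1
    · exact absurd (hpos h ▸ huv) (hirr v)
    · exact (key v u (hsymm _ _ huv) h).2

/-! ### Connected sets in a layout -/

/-- `y` can be reached from `x` along steps of the relation `D` between elements of `S`. -/
def Linked {V : Type*} (D : V → V → Prop) (S : Set V) : V → V → Prop :=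
  Relation.ReflTransGen fun a b => a ∈ S ∧ b ∈ S ∧ D a b

section Linked

variable {V : Type*} {D : V → V → Prop} {S : Set V} {x y : V}

theorem Linked.mem (h : Linked D S x y) (hx : x ∈ S) : y ∈ S := by
  induction h with
  | refl => exact hx
  | tail _ h _ => exact h.2.1

theorem Linked.symm (hD : ∀ u v, D u v → D v u) (h : Linked D S x y) : Linked D S y x := by
  induction h with
  | refl => exact .refl
  | tail _ h ih => exact .head ⟨h.2.1, h.1, hD _ _ h.2.2⟩ ih

theorem Linked.of_connected {G : SimpleGraph V} (h : (G.induce S).Connected) (hx : x ∈ S)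
    (hy : y ∈ S) : Linked G.Adj S x y := by
  have h1 := (SimpleGraph.reachable_iff_reflTransGen _ _).1 (h.preconnected ⟨x, hx⟩ ⟨y, hy⟩)
  exact h1.lift Subtype.val fun a b hab => ⟨a.2, b.2, hab⟩

/-- A linked set covers every time between two times that it covers. -/
theorem Linked.exists_time {lo hi : V → ℕ} (hL : IsLayout D lo hi) (hD : ∀ u v, D u v → D v u)
    (h : Linked D S x y) {t : ℕ} (hx : lo x ≤ t) (hy : t ≤ hi y) :
    ∃ w, Linked D S x w ∧ lo w ≤ t ∧ t ≤ hi w := by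
  by_contra! hc
  suffices hi y < t by omega
  have hlt : ∀ w, Linked D S x w → hi w < t := by
    intro w hw
    induction hw with
    | refl => exact hc _ .refl hx
    | tail h1 h2 ih =>
      have := hL.near _ _ (hD _ _ h2.2.2)
      exact hc _ (h1.tail h2) (by omega)
  exact hlt y h

theorem Linked.exists_bounds [Finite V] {lo hi : V → ℕ} (hL : IsLayout D lo hi)
    (hD : ∀ u v, D u v → D v u) (x : V) :
    ∃ a b, (∀ y, Linked D S x y → a ≤ lo y ∧ hi y ≤ b) ∧
      ∀ t, a ≤ t → t ≤ b → ∃ w, Linked D S x w ∧ lo w ≤ t ∧ t ≤ hi w := by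
  have hfin : {y | Linked D S x y}.Finite := Set.toFinite _
  obtain ⟨p, hp, hp'⟩ := Set.exists_min_image _ lo hfin ⟨x, .refl⟩
  obtain ⟨q, hq, hq'⟩ := Set.exists_max_image _ hi hfin ⟨x, .refl⟩
  refine ⟨lo p, hi q, fun y hy => ⟨hp' y hy, hq' y hy⟩, fun t h1 h2 => ?_⟩
  obtain ⟨w, hw, h3⟩ := Linked.exists_time hL hD
    (Relation.ReflTransGen.trans (Linked.symm hD hp) hq) h1 h2
  exact ⟨w, Relation.ReflTransGen.trans hp hw, h3⟩

end Linked

/-- In a layout, the connected sets that avoid two given components and are adjacent to both of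
them are hit by four vertices. -/
theorem exists_hitting_four {V : Type*} [Finite V] [Nonempty V] {D : V → V → Prop}
    {lo hi : V → ℕ} (hL : IsLayout D lo hi) (hD : ∀ u v, D u v → D v u) {X Y : Set V}
    (hXY : Disjoint X Y) (a b : V) :
    ∃ w : Fin 4 → V, ∀ T : Set V, Disjoint T X → Disjoint T Y →
      (∀ s ∈ T, ∀ t ∈ T, Linked D T s t) →
      (∃ s ∈ T, ∃ x ∈ X, Linked D X a x ∧ D s x) →
      (∃ s ∈ T, ∃ y ∈ Y, Linked D Y b y ∧ D s y) → ∃ i, w i ∈ T := by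
  -- Links preserve membership, so if `a ∉ X` or `b ∉ Y` no `T` qualifies and any witness will do.
  by_cases hab : ¬ (a ∈ X ∧ b ∈ Y)
  · refine ⟨fun _ => Classical.arbitrary V, fun T _ _ _ ⟨s, _, x, hx, hax, _⟩
      ⟨s', _, y, hy, hby, _⟩ => absurd ⟨?_, ?_⟩ hab⟩
    · exact (Linked.symm hD hax).mem hx
    · exact (Linked.symm hD hby).mem hy
  obtain ⟨ha, hb⟩ := not_not.1 hab
  obtain ⟨a₀, a₁, hA, hA'⟩ := Linked.exists_bounds (S := X) hL hD a
  obtain ⟨b₀, b₁, hB, hB'⟩ := Linked.exists_bounds (S := Y) hL hD b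
  -- The two times just outside the common span of the components of `a` and `b`. Truncation of the
  -- subtraction at 0 is harmless: missing time 0 still forces `T` to start later.
  obtain ⟨p, q, hpq⟩ := hL.width (max a₀ b₀ - 1)
  obtain ⟨p', q', hpq'⟩ := hL.width (min a₁ b₁ + 1)
  refine ⟨![p, q, p', q'], fun T hTX hTY hT ⟨s, hs, x, hx, hax, hsx⟩ ⟨s', hs', y, hy, hby, hsy⟩ =>
    ?_⟩
  by_contra! hc
  have hp : p ∉ T := hc 0
  have hq : q ∉ T := hc 1
  have hp' : p' ∉ T := hc 2
  have hq' : q' ∉ T := hc 3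
  obtain ⟨c, d, hC, hC'⟩ := Linked.exists_bounds (S := T) hL hD s
  have hu : ¬ (c ≤ max a₀ b₀ - 1 ∧ max a₀ b₀ - 1 ≤ d) := fun h => by
    obtain ⟨w, hw, h1, h2⟩ := hC' _ h.1 h.2
    rcases hpq w h1 h2 with rfl | rfl
    exacts [hp (hw.mem hs), hq (hw.mem hs)]
  have hv : ¬ (c ≤ min a₁ b₁ + 1 ∧ min a₁ b₁ + 1 ≤ d) := fun h => by
    obtain ⟨w, hw, h1, h2⟩ := hC' _ h.1 h.2
    rcases hpq' w h1 h2 with rfl | rfl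
    exacts [hp' (hw.mem hs), hq' (hw.mem hs)]
  have h1 := hA x hax
  have h2 := hB y hby
  have h3 := hC s .refl
  have h4 := hC s' (hT s hs s' hs')
  have h5 := hL.near _ _ hsx
  have h6 := hL.near _ _ (hD _ _ hsx)
  have h7 := hL.near _ _ hsy
  have h8 := hL.near _ _ (hD _ _ hsy)
  have h9 := hL.le s
  -- Adjacency lets `T` neither end before the first of these times nor start after the second. As
  -- it misses both, it lives within the common span, and its starting time `c` is covered by three
  -- disjoint sets.
  obtain ⟨w₁, hw₁, k1⟩ := hC' c le_rfl (by omega)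
  obtain ⟨w₂, hw₂, k2⟩ := hA' c (by omega) (by omega)
  obtain ⟨w₃, hw₃, k3⟩ := hB' c (by omega) (by omega)
  have m1 := hw₁.mem hs
  have m2 := hw₂.mem ha
  have m3 := hw₃.mem hb
  have n1 : w₁ ≠ w₂ := fun h => hTX.ne_of_mem m1 m2 h
  have n2 : w₁ ≠ w₃ := fun h => hTY.ne_of_mem m1 m3 h
  have n3 : w₂ ≠ w₃ := fun h => hXY.ne_of_mem m2 m3 h
  obtain ⟨p, q, hpq⟩ := hL.width c
  rcases hpq w₁ k1.1 k1.2 with r1 | r1 <;> rcases hpq w₂ k2.1 k2.2 with r2 | r2 <;>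
    rcases hpq w₃ k3.1 k3.2 with r3 | r3 <;> simp_all

/-! ### Type-I graphs as ladders -/

namespace RefCycle

variable {V : Type*} {H : SimpleGraph V} (C : RefCycle H)

/-- The position of a vertex on the reference cycle, counted from the vertex `o`. -/
def pos (o v : V) : ℕ := (C.vert.symm v - C.vert.symm o).val

theorem pos_lt (o v : V) : C.pos o v < C.len := Fin.isLt _

theorem pos_eq (o v : V) : C.pos o v =
    if (C.vert.symm o).val ≤ (C.vert.symm v).val then (C.vert.symm v).val - (C.vert.symm o).val
    else C.len + (C.vert.symm v).val - (C.vert.symm o).val := by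
  have h1 := (C.vert.symm o).isLt
  have h2 := (C.vert.symm v).isLt
  rw [pos, Fin.val_sub]
  split_ifs with h
  · rw [show C.len - (C.vert.symm o).val + (C.vert.symm v).val =
      (C.vert.symm v).val - (C.vert.symm o).val + C.len by omega, Nat.add_mod_right,
      Nat.mod_eq_of_lt (by omega)]
  · rw [Nat.mod_eq_of_lt (by omega)]
    omega

theorem pos_self (o : V) : C.pos o o = 0 := by simp [pos_eq]

theorem pos_injective (o : V) : Function.Injective (C.pos o) := fun u v h => by
  rw [pos_eq, pos_eq] at h
  refine C.vert.symm.injective (Fin.ext ?_)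
  have h1 := (C.vert.symm o).isLt
  have h2 := (C.vert.symm u).isLt
  have h3 := (C.vert.symm v).isLt
  split_ifs at h <;> omega

theorem finite {V : Type*} {H : SimpleGraph V} (C : RefCycle H) : Finite V := Finite.of_equiv _ C.vert

theorem exists_pos_eq (o : V) {n : ℕ} (hn : n < C.len) : ∃ v, C.pos o v = n := by
  have : Finite V := C.finite
  let f : V → Fin C.len := fun v => ⟨C.pos o v, C.pos_lt o v⟩
  have hf : Function.Injective f := fun u v h => C.pos_injective o (Fin.mk.inj_iff.1 h)
  have hs := (hf.bijective_of_nat_card_le (by rw [Nat.card_congr C.vert])).2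
  obtain ⟨v, hv⟩ := hs ⟨n, hn⟩
  exact ⟨v, Fin.mk.inj_iff.1 hv⟩

theorem cycle_adj_iff (o u v : V) : C.cycle.Adj u v ↔ C.pos o v = C.pos o u + 1 ∨
    C.pos o u = C.pos o v + 1 ∨ (C.pos o u = 0 ∧ C.pos o v = C.len - 1) ∨
    (C.pos o v = 0 ∧ C.pos o u = C.len - 1) := by
  have h1 := (C.vert.symm o).isLt
  have h2 := (C.vert.symm u).isLt
  have h3 := (C.vert.symm v).isLt
  have h4 := C.three_le
  have key : C.cycle.Adj u v ↔ C.pos v u = 1 ∨ C.pos u v = 1 := by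
    rw [pos, pos, ← SimpleGraph.cycleGraph_adj', cycle, SimpleGraph.map_adj']
    constructor
    · rintro ⟨-, x, y, hxy, rfl, rfl⟩
      simpa using hxy
    · intro h
      exact ⟨fun h' => h.ne (congrArg _ h'), _, _, h, by simp, by simp⟩
  rw [key, C.pos_eq v u, C.pos_eq u v, C.pos_eq o u, C.pos_eq o v]
  split_ifs <;> omega

theorem inOrder_iff (o a c b d : V) : C.InOrder a c b d ↔
    ((C.pos o a < C.pos o c ∧ C.pos o c < C.pos o b) ∨
      (C.pos o c < C.pos o b ∧ C.pos o b < C.pos o a) ∨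
      (C.pos o b < C.pos o a ∧ C.pos o a < C.pos o c)) ∧
    ((C.pos o b < C.pos o d ∧ C.pos o d < C.pos o a) ∨
      (C.pos o d < C.pos o a ∧ C.pos o a < C.pos o b) ∨
      (C.pos o a < C.pos o b ∧ C.pos o b < C.pos o d)) := by
  have key : ∀ x y z : Fin C.len, sbtw x y z ↔
      (x.val < y.val ∧ y.val < z.val) ∨ (y.val < z.val ∧ z.val < x.val) ∨
      (z.val < x.val ∧ x.val < y.val) := fun x y z => Iff.rfl
  have h1 := (C.vert.symm o).isLt
  have h2 := (C.vert.symm a).isLt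
  have h3 := (C.vert.symm b).isLt
  have h4 := (C.vert.symm c).isLt
  have h5 := (C.vert.symm d).isLt
  rw [InOrder, key, key]
  simp only [pos_eq]
  refine and_congr ?_ ?_ <;> split_ifs <;> omega

variable {C}

theorem reachable_of_pos {o : V} {E : Set (Sym2 V)} {u v : V} (huv : C.pos o u ≤ C.pos o v)
    (hE : ∀ x y, C.pos o u ≤ C.pos o x → C.pos o y = C.pos o x + 1 → C.pos o y ≤ C.pos o v →
      s(x, y) ∉ E) : (C.cycle.deleteEdges E).Reachable u v := by
  obtain ⟨n, hn⟩ := Nat.exists_eq_add_of_le huv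
  induction n generalizing v with
  | zero => exact C.pos_injective o hn ▸ .refl _
  | succ n ih =>
    obtain ⟨w, hw⟩ := C.exists_pos_eq o (n := C.pos o u + n) (by have := C.pos_lt o v; omega)
    refine (ih (by omega) (fun x y h1 h2 h3 => hE x y h1 h2 (by omega)) hw).trans ?_
    refine SimpleGraph.Adj.reachable (SimpleGraph.deleteEdges_adj.2 ⟨?_, ?_⟩)
    · exact (C.cycle_adj_iff o _ _).2 (Or.inl (by omega))
    · exact hE w v (by omega) (by omega) le_rfl

/-- The set `K` contains the ends of the two sides. Dropping the edges within `K` removes the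
closing edges of the cycle and the one kind of crossing that a ladder cannot accommodate. -/
theorem IsTypeI.exists_isLayout (hI : C.IsTypeI) {o : V} {k : ℕ} (hk : k + 1 < C.len)
    (hch : ∀ u v, C.Chord u v → C.pos o u < C.pos o v → C.pos o u ≤ k ∧ k < C.pos o v)
    {K : Set V} (hK : ∀ v, C.pos o v = 0 ∨ C.pos o v = C.len - 1 ∨ C.pos o v = k ∨
      C.pos o v = k + 1 → v ∈ K) :
    ∃ lo hi : V → ℕ, IsLayout (fun u v => H.Adj u v ∧ ¬ (u ∈ K ∧ v ∈ K)) lo hi := by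
  have : Nonempty V := ⟨o⟩
  obtain ⟨l, hl⟩ := Nat.exists_eq_add_of_lt hk
  have hN : C.len = k + l + 2 := by omega
  have hsymm : ∀ u v, H.Adj u v ∧ ¬ (u ∈ K ∧ v ∈ K) → H.Adj v u ∧ ¬ (v ∈ K ∧ u ∈ K) :=
    fun u v h => ⟨h.1.symm, fun h' => h.2 h'.symm⟩
  have hirr : ∀ v, ¬ (H.Adj v v ∧ ¬ (v ∈ K ∧ v ∈ K)) := fun v h => H.loopless.irrefl v h.1
  have hcyc : ∀ u v, C.cycle.Adj u v → ¬ (u ∈ K ∧ v ∈ K) → C.pos o u < C.pos o v →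
      C.pos o v = C.pos o u + 1 ∧ C.pos o u ≠ k := by
    intro u v h h' hlt
    have h1 : C.pos o v = C.pos o u + 1 := by
      rcases (C.cycle_adj_iff o u v).1 h with h | h | h | h
      · exact h
      · omega
      · exact absurd ⟨hK _ (Or.inl h.1), hK _ (Or.inr (Or.inl h.2))⟩ h'
      · omega
    refine ⟨h1, fun h2 => h' ⟨hK _ ?_, hK _ ?_⟩⟩ <;> omega
  -- The exceptional crossing: two chords joining opposite ends of the sides. Any other chord not
  -- within `K` would cross one of them, which already crosses its partner, so only cycle edges
  -- remain and the ladder needs no rungs.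
  by_cases hirreg : 0 < k ∧ k + 1 < C.len - 1 ∧
      (∃ u v, C.Chord u v ∧ C.pos o u = 0 ∧ C.pos o v = k + 1) ∧
      ∃ u v, C.Chord u v ∧ C.pos o u = k ∧ C.pos o v = C.len - 1
  · obtain ⟨hk0, hk1, ⟨a, b, hab, ha, hb⟩, c, d, hcd, hc, hd⟩ := hirreg
    have haK := hK a (Or.inl ha)
    have hbK := hK b (Or.inr (Or.inr (Or.inr hb)))
    have hcK := hK c (Or.inr (Or.inr (Or.inl hc)))
    have hdK := hK d (Or.inr (Or.inl hd))
    have hends : ∀ x y p q : V, p ∈ K → q ∈ K → s(x, y) = s(p, q) → x ∈ K ∧ y ∈ K := by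
      intro x y p q hp hq h
      rcases Sym2.eq_iff.1 h with ⟨rfl, rfl⟩ | ⟨rfl, rfl⟩
      exacts [⟨hp, hq⟩, ⟨hq, hp⟩]
    refine exists_isLayout_of_ladder hsymm hirr (C.pos_injective o) (k := k) (l := l)
      (R := fun _ _ => False) (fun v => hN ▸ C.pos_lt o v) (by simp) (by simp)
      fun u v huv hlt => ?_
    by_cases hcy : C.cycle.Adj u v
    · exact Or.inl (hcyc u v hcy huv.2 hlt)
    exfalso
    have huvc : C.Chord u v := ⟨huv.1, hcy⟩
    have h1 := hch u v huvc hlt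
    have h2 := C.pos_lt o v
    apply huv.2
    by_cases h3 : 0 < C.pos o u ∧ k + 1 < C.pos o v
    · refine hends u v c d hcK hdK (hI.1 a b u v c d hab huvc hcd (Or.inl ?_) (Or.inl ?_))
      · rw [C.inOrder_iff o]
        omega
      · rw [C.inOrder_iff o]
        omega
    by_cases h4 : C.pos o u < k ∧ C.pos o v < C.len - 1
    · refine hends u v a b haK hbK (hI.1 c d u v a b hcd huvc hab (Or.inr ?_) (Or.inr ?_))
      · rw [C.inOrder_iff o]
        omega
      · rw [C.inOrder_iff o]
        omega
    exact ⟨hK _ (by omega), hK _ (by omega)⟩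
  · refine exists_isLayout_of_ladder hsymm hirr (C.pos_injective o) (k := k) (l := l)
      (R := fun i j => ∃ u v, C.Chord u v ∧ C.pos o u = i ∧ i ≤ k ∧ k < C.pos o v ∧
        k + l + 1 - C.pos o v = j) (fun v => hN ▸ C.pos_lt o v) ?_ ?_ fun u v huv hlt => ?_
    · rintro i j ⟨u, v, -, -, h1, h2, h3⟩
      omega
    · rintro i j i' j' ⟨u, v, h, rfl, h2, h3, rfl⟩ ⟨u', v', h', rfl, h2', h3', rfl⟩ hi hj
      have hv := C.pos_lt o v
      have hv' := C.pos_lt o v'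
      have hcr : C.Cross u v u' v' := Or.inl (by rw [C.inOrder_iff o]; omega)
      -- The type-I condition makes the ends consecutive on each side, or else joins each chord's
      -- ends to the other's by the two closing edges, which is the excluded exceptional crossing.
      have h4 := hI.2 u v u' v' h h' hcr
      rw [C.cycle_adj_iff o, C.cycle_adj_iff o, C.cycle_adj_iff o, C.cycle_adj_iff o] at h4
      by_contra hc
      refine hirreg ⟨by omega, by omega, ⟨u, v, h, ?_, ?_⟩, u', v', h', ?_, ?_⟩ <;> omega
    · by_cases hcy : C.cycle.Adj u v
      · exact Or.inl (hcyc u v hcy huv.2 hlt)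
      · have h1 := hch u v ⟨huv.1, hcy⟩ hlt
        exact Or.inr ⟨h1.1, h1.2, u, v, ⟨huv.1, hcy⟩, rfl, h1.1, h1.2, rfl⟩

theorem IsTypeI.exists_isLayout_of_edges (hI : C.IsTypeI) {a b c d : V}
    (hb : C.pos a b = C.len - 1) (hd : C.pos a d = C.pos a c + 1)
    (hch : C.ChordsBetween s(a, b) s(c, d)) :
    ∃ lo hi : V → ℕ, IsLayout (fun u v => H.Adj u v ∧
      ¬ (u ∈ ({a, b, c, d} : Set V) ∧ v ∈ ({a, b, c, d} : Set V))) lo hi := by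
  have h3 := C.three_le
  have hinj := C.pos_injective a
  have hdl := C.pos_lt a d
  have ha := C.pos_self a
  refine hI.exists_isLayout (o := a) (k := C.pos a c) (by omega) (fun u v huv hlt => ?_)
    fun v hv => ?_
  · by_contra hc
    -- A chord with both ends on one side would have its ends joined by a segment of the cycle
    -- containing neither `ab` nor `cd`.
    refine hch u v huv (reachable_of_pos hlt.le fun x y h1 h2 h4 h5 => ?_)
    simp only [Set.mem_insert_iff, Set.mem_singleton_iff, Sym2.eq_iff] at h5
    rcases h5 with (⟨rfl, rfl⟩ | ⟨rfl, rfl⟩) | (⟨rfl, rfl⟩ | ⟨rfl, rfl⟩) <;> omega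
  · rcases hv with h | h | h | h
    · exact Or.inl (hinj (h.trans ha.symm))
    · exact Or.inr (Or.inl (hinj (h.trans hb.symm)))
    · exact Or.inr (Or.inr (Or.inl (hinj h)))
    · exact Or.inr (Or.inr (Or.inr (hinj (h.trans hd.symm))))

theorem ChordsBetween.symm {e f : Sym2 V} (h : C.ChordsBetween e f) : C.ChordsBetween f e := by
  rw [ChordsBetween, Set.pair_comm]
  exact h

theorem pos_of_cycle_adj {a b : V} (h : C.cycle.Adj a b) :
    C.pos a b = 1 ∨ C.pos a b = C.len - 1 := by
  have ha := C.pos_self a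
  have h3 := C.three_le
  rw [C.cycle_adj_iff a] at h
  omega

theorem pos_rev {a b : V} (h : C.pos a b = 1) : C.pos b a = C.len - 1 := by
  have h1 := C.pos_self a
  have h2 := C.pos_self b
  have h3 := C.three_le
  have h4 := (C.vert.symm a).isLt
  have h5 := (C.vert.symm b).isLt
  rw [pos_eq] at h ⊢
  split_ifs at h ⊢ <;> omega

end RefCycle

/-! ### Layouts of fans and strips -/

theorem IsLayout.mono {V : Type*} {D D' : V → V → Prop} {lo hi : V → ℕ} (h : IsLayout D lo hi)
    (hD : ∀ u v, D' u v → D u v) : IsLayout D' lo hi :=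
  ⟨h.le, h.width, fun u v huv => h.near u v (hD u v huv)⟩

/-- A fan is the degenerate ladder with the center alone on one side (`k = 0`). -/
theorem IsFan.exists_isLayout {V : Type*} {H : SimpleGraph V} {a b c : V} (h : IsFan H a b c) :
    ∃ lo hi : V → ℕ, IsLayout (fun u v => H.Adj u v ∧
      ¬ (u ∈ ({a, b, c} : Set V) ∧ v ∈ ({a, b, c} : Set V))) lo hi := by
  obtain ⟨C, hI, hbc, hab, hac, hch⟩ := h
  have ha := C.pos_self a
  have hne : C.pos a b ≠ C.pos a c := fun h => hbc (C.pos_injective a h)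
  have e1 : ({a, b, a, c} : Set V) = {a, b, c} := by ext; simp; tauto
  have e2 : ({a, c, a, b} : Set V) = {a, b, c} := by ext; simp; tauto
  rcases RefCycle.pos_of_cycle_adj hab with h1 | h1
  · rcases RefCycle.pos_of_cycle_adj hac with h2 | h2
    · omega
    · simpa only [e2] using hI.exists_isLayout_of_edges h2 (by omega) hch.symm
  · rcases RefCycle.pos_of_cycle_adj hac with h2 | h2
    · simpa only [e1] using hI.exists_isLayout_of_edges h1 (by omega) hch
    · omega

/-- Deleting edges preserves a layout, so `F` plays no role; the rest is a choice of origin and of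
the order of `c`, `d`. -/
theorem IsStrip.exists_isLayout {V : Type*} {J : SimpleGraph V} {a b c d : V}
    (h : IsStrip J a b c d) :
    ∃ lo hi : V → ℕ, IsLayout (fun u v => J.Adj u v ∧
      ¬ (u ∈ ({a, b, c, d} : Set V) ∧ v ∈ ({a, b, c, d} : Set V))) lo hi := by
  obtain ⟨H, C, F, hI, hab, hcd, hac, had, hbc, hbd, hch, -, rfl, -⟩ := h
  have key : ∀ a b c d : V, C.cycle.Adj c d → a ≠ c → a ≠ d → C.pos a b = C.len - 1 →
      C.ChordsBetween s(a, b) s(c, d) → ∃ lo hi : V → ℕ, IsLayout (fun u v => H.Adj u v ∧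
      ¬ (u ∈ ({a, b, c, d} : Set V) ∧ v ∈ ({a, b, c, d} : Set V))) lo hi := by
    intro a b c d hcd hac had hb hch
    have ha := C.pos_self a
    have h1 : C.pos a a ≠ C.pos a c := fun h => hac (C.pos_injective a h)
    have h2 : C.pos a a ≠ C.pos a d := fun h => had (C.pos_injective a h)
    rcases (C.cycle_adj_iff a c d).1 hcd with h | h | h | h
    · exact hI.exists_isLayout_of_edges hb h hch
    · have e : ({a, b, d, c} : Set V) = {a, b, c, d} := by ext; simp; tauto
      have := hI.exists_isLayout_of_edges hb h (Sym2.eq_swap (a := c) ▸ hch)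
      simpa only [e] using this
    · omega
    · omega
  suffices h : ∃ lo hi : V → ℕ, IsLayout (fun u v => H.Adj u v ∧
      ¬ (u ∈ ({a, b, c, d} : Set V) ∧ v ∈ ({a, b, c, d} : Set V))) lo hi by
    obtain ⟨lo, hi, h⟩ := h
    exact ⟨lo, hi, h.mono fun u v huv => ⟨(SimpleGraph.deleteEdges_adj.1 huv.1).1, huv.2⟩⟩
  rcases RefCycle.pos_of_cycle_adj hab with h1 | h1
  · have e : ({b, a, c, d} : Set V) = {a, b, c, d} := by ext; simp; tauto
    have := key b a c d hcd hbc hbd (RefCycle.pos_rev h1) (Sym2.eq_swap (a := a) ▸ hch)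
    simpa only [e] using this
  · exact key a b c d hcd hac had h1 hch

namespace Piece

/-- Adjacency in a piece, except between two corners. -/
def InnerAdj (P : Piece) (u v : P.Vtx) : Prop :=
  P.graph.Adj u v ∧ ¬ (u ∈ P.corners ∧ v ∈ P.corners)

theorem InnerAdj.symm {P : Piece} {u v : P.Vtx} (h : P.InnerAdj u v) : P.InnerAdj v u :=
  ⟨h.1.symm, fun h' => h.2 h'.symm⟩

theorem exists_isLayout (P : Piece) : ∃ lo hi : P.Vtx → ℕ, IsLayout P.InnerAdj lo hi := by
  unfold InnerAdj
  rcases P.spec with ⟨a, b, c, h, h', -⟩ | ⟨a, b, c, d, h, h', -⟩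
  · rw [h']
    exact h.exists_isLayout
  · rw [h']
    exact h.exists_isLayout

theorem finite (P : Piece) : Finite P.Vtx := by
  rcases P.spec with ⟨a, b, c, ⟨C, -⟩, -⟩ | ⟨a, b, c, d, ⟨H, C, -⟩, -⟩
  exacts [C.finite, C.finite]

theorem exists_corners_range (P : Piece) :
    ∃ c : Fin 4 → P.Vtx, ∀ x, x ∈ P.corners ↔ ∃ i, c i = x := by
  rcases P.spec with ⟨a, b, c, -, h, -⟩ | ⟨a, b, c, d, -, h, -⟩
  · refine ⟨![a, b, c, c], fun x => ?_⟩
    simp [h, Fin.exists_fin_succ, eq_comm]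
  · refine ⟨![a, b, c, d], fun x => ?_⟩
    simp [h, Fin.exists_fin_succ, eq_comm]

theorem exists_three_corners (P : Piece) : ∃ a b c, a ∈ P.corners ∧ b ∈ P.corners ∧
    c ∈ P.corners ∧ a ≠ b ∧ a ≠ c ∧ b ≠ c := by
  rcases P.spec with ⟨a, b, c, ⟨C, -, hbc, hab, hac, -⟩, h, -⟩ |
    ⟨a, b, c, d, ⟨H, C, F, -, hab, hcd, hac, had, -⟩, h, -⟩
  · exact ⟨a, b, c, by simp [h], by simp [h], by simp [h], hab.ne, hac.ne, hbc⟩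
  · exact ⟨a, c, d, by simp [h], by simp [h], by simp [h], hac, had, hcd.ne⟩

theorem exists_corner_ne_center (P : Piece) : ∃ x : P.corners, P.center ≠ some x.1 := by
  obtain ⟨a, b, -, ha, hb, -, hab, -⟩ := P.exists_three_corners
  by_cases h : P.center = some a
  · exact ⟨⟨b, hb⟩, fun h' => hab (Option.some_injective _ (h.symm.trans h'))⟩
  · exact ⟨⟨a, ha⟩, h⟩

end Piece

-- Connected sets in an augmentation

universe u v w

namespace Attachment

variable {V : Type u} (A : Attachment V) {G₀ : SimpleGraph V}

theorem place_injective (i : A.ι) : Function.Injective (A.place i) := by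
  intro x y h
  unfold place at h
  split_ifs at h with hx hy hy
  · exact congrArg Subtype.val (A.att_injective i (Sum.inl_injective h))
  · simpa using h

variable {A}

theorem graph_adj_iff {u v : A.Vertex} : (A.graph G₀).Adj u v ↔ u ≠ v ∧
    ((∃ a b, G₀.Adj a b ∧ Sum.inl a = u ∧ Sum.inl b = v) ∨
      ∃ i x y, (A.piece i).graph.Adj x y ∧ A.place i x = u ∧ A.place i y = v) := by
  simp only [graph, SimpleGraph.sup_adj, SimpleGraph.iSup_adj, SimpleGraph.map_adj']
  constructor
  · rintro (⟨h, a, b, h'⟩ | ⟨i, h, x, y, h'⟩)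
    exacts [⟨h, Or.inl ⟨a, b, h'⟩⟩, ⟨h, Or.inr ⟨i, x, y, h'⟩⟩]
  · rintro ⟨h, ⟨a, b, h'⟩ | ⟨i, x, y, h'⟩⟩
    exacts [Or.inl ⟨h, a, b, h'⟩, Or.inr ⟨i, h, x, y, h'⟩]

theorem place_of_notMem {i : A.ι} {x : (A.piece i).Vtx} (hx : x ∉ (A.piece i).corners) :
    A.place i x = Sum.inr ⟨i, x, hx⟩ := dif_neg hx

/-- Pieces meet the rest of the graph only in corners, so a non-corner vertex has all its neighbors
in its own piece. -/
theorem exists_innerAdj {i : A.ι} {x : (A.piece i).Vtx} (hx : x ∉ (A.piece i).corners)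
    {v : A.Vertex} (h : (A.graph G₀).Adj (A.place i x) v) :
    ∃ y, A.place i y = v ∧ (A.piece i).InnerAdj x y := by
  obtain ⟨-, ⟨a, b, -, h', -⟩ | ⟨j, x', y, hxy, h', rfl⟩⟩ := graph_adj_iff.1 h
  · rw [place_of_notMem hx] at h'
    cases h'
  · have hij : j = i := by
      rw [place_of_notMem hx, place] at h'
      split_ifs at h'
      exact (Sigma.mk.inj_iff.1 (Sum.inr_injective h')).1
    subst hij
    obtain rfl := A.place_injective j h'
    exact ⟨y, rfl, hxy, fun h => hx h.1⟩

/-- A connected set either stays in a piece or leaves it through a corner. -/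
theorem linked_or_exists_corner {i : A.ι} {S : Set A.Vertex} {x : (A.piece i).Vtx}
    {v : A.Vertex} (h : Linked (A.graph G₀).Adj S (A.place i x) v) :
    (∃ y, A.place i y = v ∧ Linked (A.piece i).InnerAdj (A.place i ⁻¹' S) x y) ∨
      ∃ c ∈ (A.piece i).corners, Linked (A.piece i).InnerAdj (A.place i ⁻¹' S) x c := by
  induction h with
  | refl => exact Or.inl ⟨x, rfl, .refl⟩
  | tail h1 h2 ih =>
    obtain ⟨y, rfl, hy⟩ | h := ih
    · by_cases hc : y ∈ (A.piece i).corners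
      · exact Or.inr ⟨y, hc, hy⟩
      · obtain ⟨z, rfl, hz⟩ := exists_innerAdj hc h2.2.2
        exact Or.inl ⟨z, rfl, hy.tail ⟨h2.1, h2.2.1, hz⟩⟩
    · exact Or.inr h

/-- The restriction of a connected set to a piece has at most four components. -/
theorem exists_representatives (i : A.ι) {S : Set A.Vertex}
    (hS : ((A.graph G₀).induce S).Connected) :
    ∃ r : Fin 4 → (A.piece i).Vtx, ∀ x, A.place i x ∈ S →
      ∃ e, Linked (A.piece i).InnerAdj (A.place i ⁻¹' S) (r e) x := by
  have hsymm : ∀ u v, (A.piece i).InnerAdj u v → (A.piece i).InnerAdj v u := fun _ _ h => h.symm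
  obtain ⟨c, hc⟩ := (A.piece i).exists_corners_range
  by_cases hcor : ∃ y ∈ (A.piece i).corners, A.place i y ∈ S
  · obtain ⟨y, hy, hyS⟩ := hcor
    refine ⟨c, fun x hx => ?_⟩
    obtain ⟨y', hyy, h⟩ | ⟨z, hz, h⟩ := linked_or_exists_corner (.of_connected hS hx hyS)
    · obtain rfl := A.place_injective i hyy
      obtain ⟨e, rfl⟩ := (hc _).1 hy
      exact ⟨e, h.symm hsymm⟩
    · obtain ⟨e, rfl⟩ := (hc _).1 hz
      exact ⟨e, h.symm hsymm⟩
  · by_cases hne : ∃ x₀, A.place i x₀ ∈ S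
    · obtain ⟨x₀, hx₀⟩ := hne
      refine ⟨fun _ => x₀, fun x hx => ⟨0, ?_⟩⟩
      obtain ⟨y, hyx, h⟩ | ⟨z, hz, h⟩ := linked_or_exists_corner (.of_connected hS hx₀ hx)
      · obtain rfl := A.place_injective i hyx
        exact h
      · exact absurd ⟨z, hz, h.mem hx₀⟩ hcor
    · exact ⟨c, fun x hx => absurd ⟨x, hx⟩ hne⟩

/-- The indices choose a component of `X`, a component of `Y` and one of four hitting vertices. As
`T` contains no corner, both `T` and its neighbors in `X` and `Y` lie in the piece. -/
theorem exists_hitting_piece (i : A.ι) {X Y : Set A.Vertex}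
    (hX : ((A.graph G₀).induce X).Connected) (hY : ((A.graph G₀).induce Y).Connected)
    (hXY : Disjoint X Y) :
    ∃ z : Fin 4 × Fin 4 × Fin 4 → (A.piece i).Vtx, ∀ T : Set A.Vertex,
      ((A.graph G₀).induce T).Connected → Disjoint T X → Disjoint T Y →
      (∃ s ∈ T, ∃ x ∈ X, (A.graph G₀).Adj s x) → (∃ s ∈ T, ∃ y ∈ Y, (A.graph G₀).Adj s y) →
      (∀ a, Sum.inl a ∉ T) → (∃ x, A.place i x ∈ T) → ∃ e, A.place i (z e) ∈ T := by
  obtain ⟨r, hr⟩ := exists_representatives i hX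
  obtain ⟨r', hr'⟩ := exists_representatives i hY
  obtain ⟨lo, hi, hL⟩ := (A.piece i).exists_isLayout
  have := (A.piece i).finite
  have : Nonempty (A.piece i).Vtx := ⟨r 0⟩
  choose z hz using fun p : Fin 4 × Fin 4 => exists_hitting_four hL (fun _ _ h => h.symm)
    (hXY.preimage (A.place i)) (r p.1) (r' p.2)
  refine ⟨fun e => z (e.1, e.2.1) e.2.2, fun T hT hTX hTY ⟨s, hs, x, hx, hsx⟩
    ⟨s', hs', y, hy, hsy⟩ hinl ⟨t, ht⟩ => ?_⟩
  have hcor : ∀ x, A.place i x ∈ T → x ∉ (A.piece i).corners := fun x hx hxc => by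
    rw [place, dif_pos hxc] at hx
    exact hinl _ hx
  have hlink : ∀ x, A.place i x ∈ T → ∀ v ∈ T,
      ∃ y, A.place i y = v ∧ Linked (A.piece i).InnerAdj (A.place i ⁻¹' T) x y := by
    intro x hx v hv
    obtain h | ⟨c, hc, h⟩ := linked_or_exists_corner (.of_connected hT hx hv)
    · exact h
    · exact absurd hc (hcor c (h.mem hx))
  obtain ⟨s, rfl, -⟩ := hlink t ht s hs
  obtain ⟨s', rfl, -⟩ := hlink t ht s' hs'
  obtain ⟨x, rfl, hsx'⟩ := exists_innerAdj (hcor s hs) hsx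
  obtain ⟨y, rfl, hsy'⟩ := exists_innerAdj (hcor s' hs') hsy
  obtain ⟨e, he⟩ := hr x hx
  obtain ⟨e', he'⟩ := hr' y hy
  obtain ⟨e'', h⟩ := hz (e, e') (A.place i ⁻¹' T) (hTX.preimage _) (hTY.preimage _)
    (fun a ha b hb => by
      obtain ⟨b', hb', h⟩ := hlink a ha _ hb
      exact A.place_injective i hb' ▸ h)
    ⟨s, hs, x, hx, he, hsx'⟩ ⟨s', hs', y, hy, he', hsy'⟩
  exact ⟨(e, e', e''), h⟩

theorem exists_hitting {X Y : Set A.Vertex}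
    (hX : ((A.graph G₀).induce X).Connected) (hY : ((A.graph G₀).induce Y).Connected)
    (hXY : Disjoint X Y) :
    ∃ z : V ⊕ (A.ι × Fin 4 × Fin 4 × Fin 4) → A.Vertex, ∀ T : Set A.Vertex,
      ((A.graph G₀).induce T).Connected → Disjoint T X → Disjoint T Y →
      (∃ s ∈ T, ∃ x ∈ X, (A.graph G₀).Adj s x) → (∃ s ∈ T, ∃ y ∈ Y, (A.graph G₀).Adj s y) →
      ∃ e, z e ∈ T := by
  choose z hz using fun i => exists_hitting_piece i hX hY hXY
  refine ⟨Sum.elim Sum.inl fun e => A.place e.1 (z e.1 e.2), fun T hT hTX hTY hx hy => ?_⟩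
  by_cases hinl : ∃ a, Sum.inl a ∈ T
  · obtain ⟨a, ha⟩ := hinl
    exact ⟨Sum.inl a, ha⟩
  · rw [not_exists] at hinl
    obtain ⟨⟨a | ⟨i, x, hxc⟩, ht⟩⟩ := hT.nonempty
    · exact absurd ht (hinl a)
    · obtain ⟨e, he⟩ := hz i T hT hTX hTY hx hy hinl ⟨x, by rwa [place_of_notMem hxc]⟩
      exact ⟨Sum.inr (i, e), he⟩

/-- Choose in each piece a corner other than its center. Two pieces can share a vertex of `V` only
if it is the center of one of them, so the chosen corners go to distinct vertices. -/
theorem card_index_le [Finite V] : Nat.card A.ι ≤ Nat.card V := by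
  choose c hc using fun i => (A.piece i).exists_corner_ne_center
  refine Nat.card_le_card_of_injective (fun i => A.att i (c i)) fun i j h => ?_
  by_contra hij
  rcases A.compat i j hij _ _ h with h | h
  exacts [hc i h.1, hc j h.1]

theorem three_le_card [Finite V] (i : A.ι) : 3 ≤ Nat.card V := by
  obtain ⟨a, b, c, ha, hb, hc, hab, hac, hbc⟩ := (A.piece i).exists_three_corners
  have hinj : Function.Injective
      (![A.att i ⟨a, ha⟩, A.att i ⟨b, hb⟩, A.att i ⟨c, hc⟩] : Fin 3 → V) := by
    have h1 : A.att i ⟨a, ha⟩ ≠ A.att i ⟨b, hb⟩ := (A.att_injective i).ne (by simpa using hab)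
    have h2 : A.att i ⟨a, ha⟩ ≠ A.att i ⟨c, hc⟩ := (A.att_injective i).ne (by simpa using hac)
    have h3 : A.att i ⟨b, hb⟩ ≠ A.att i ⟨c, hc⟩ := (A.att_injective i).ne (by simpa using hbc)
    intro x y hxy
    fin_cases x <;> fin_cases y <;> simp_all
  simpa using Nat.card_le_card_of_injective _ hinj

/-- An augmentation of a graph on `n` vertices by `p` fans and strips has no `K_{2,m}`-minor with
`m > n + 64 p`. -/
theorem le_of_isMinor_K2 [Finite V] {m : ℕ} (h : IsMinor (K2 m) (A.graph G₀)) :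
    m ≤ Nat.card V + 64 * Nat.card A.ι := by
  obtain ⟨B, hB, hdisj, hadj⟩ := h
  have := A.finite_ι
  obtain ⟨z, hz⟩ := exists_hitting (hB (Sum.inl 0)) (hB (Sum.inl 1)) (hdisj _ _ (by simp))
  have key : ∀ j : Fin m, ∃ e, z e ∈ B (Sum.inr j) := fun j =>
    hz _ (hB _) (hdisj _ _ (by simp)) (hdisj _ _ (by simp)) (hadj _ _ (by simp))
      (hadj _ _ (by simp))
  choose e he using key
  have hinj : Function.Injective e := fun j j' h => by
    by_contra hne
    exact (hdisj (Sum.inr j) (Sum.inr j') (by simpa using hne)).ne_of_mem (he j) (he j')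
      (congrArg z h)
  have hcard := Nat.card_le_card_of_injective e hinj
  simp only [Nat.card_sum, Nat.card_prod, Nat.card_fin] at hcard
  omega

end Attachment

/-! ### Isomorphism invariance and the final count -/

theorem IsMinor.of_iso {U : Type w} {V : Type u} {W : Type v} {H : SimpleGraph U}
    {G : SimpleGraph V} {G' : SimpleGraph W} (φ : G ≃g G') (h : IsMinor H G) : IsMinor H G' := by
  obtain ⟨B, hB, hdisj, hadj⟩ := h
  refine ⟨fun x => φ '' B x, fun x => ?_, fun x y hxy => ?_, fun x y hxy => ?_⟩
  · exact (SimpleGraph.Iso.connected_iff (φ.induce (φ.injective.injOn.bijOn_image))).1 (hB x)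
  · exact (Set.disjoint_image_iff φ.injective).2 (hdisj x y hxy)
  · obtain ⟨s, hs, t, ht, hst⟩ := hadj x y hxy
    exact ⟨φ s, ⟨s, hs, rfl⟩, φ t, ⟨t, ht, rfl⟩, φ.map_adj_iff.2 hst⟩

end Aug

theorem mainTheorem8 :
    ∃ f : ℕ → ℕ, (∀ n, f n = 10 * n * 2 ^ n) ∧
      ∀ (n : ℕ) (V : Type*) (W : Type*) [Finite V] (G₀ : SimpleGraph V) (G : SimpleGraph W),
        Nat.card V ≤ n → Aug.IsAugmentation G₀ G → ¬ Aug.IsMinor (Aug.K2 (f n)) G := by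
  refine ⟨fun n => 10 * n * 2 ^ n, fun n => rfl, ?_⟩
  rintro n V W _ G₀ G hn ⟨A, ⟨φ⟩⟩ hG
  have hm := hG.of_iso φ
  have hle := Aug.Attachment.le_of_isMinor_K2 hm
  have hι := A.card_index_le
  beta_reduce at hle
  -- For `n = 0` counting gives only `0 ≤ 0`, but `K_{2,0}` still needs nonempty branch sets and the
  -- augmentation is empty.
  rcases Nat.eq_zero_or_pos n with rfl | hpos
  · have hV : IsEmpty V := (Finite.card_eq_zero_iff).1 (Nat.le_zero.1 hn)
    obtain ⟨B, hB, -⟩ := hm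
    obtain ⟨⟨a | ⟨i, -⟩, -⟩⟩ := (hB (Sum.inl 0)).nonempty
    · exact hV.elim a
    · have := A.three_le_card i
      omega
  · rcases isEmpty_or_nonempty A.ι with h | ⟨⟨i⟩⟩
    · rw [Nat.card_of_isEmpty (α := A.ι)] at hle
      have : 1 ≤ 2 ^ n := Nat.one_le_two_pow
      nlinarith
    -- A piece has three distinct corners, so `n ≥ 3` and `10 n * 2 ^ n ≥ 80 n > 65 n`.
    · have h3 := A.three_le_card i
      have : 2 ^ 3 ≤ 2 ^ n := Nat.pow_le_pow_right two_pos (h3.trans hn)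
      nlinarith
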